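/- A linking pairing on a finite abelian group $G$ is a symmetric bilinear map $\nu\colon G\times G\to\mathbb{Q}/\mathbb{Z}$ that is non-singular, i.e. the adjoint homomorphism $G\to\operatorname{Hom}(G,\mathbb{Q}/\mathbb{Z})$ is an isomorphism. Two pairings $\nu$ on $G$ and $\nu'$ on $G'$ are isomorphic if some group isomorphism $G\to G'$ carries $\nu$ to $\nu'$; their block sum is the pairing $((x,x'),(y,y'))\mapsto\nu(x,y)+\nu'(x',y')$ on $G\oplus G'$. For a symmetric integer $n\times n$ matrix $A$ ($n\ge 0$) with $\det A\ne 0$, let $\phi(A)$ be the pairing on $\mathbb{Z}^n/A\mathbb{Z}^n$ given by $\phi(A)(v,w)=v^{t}A^{-1}w \bmod \mathbb{Z}$. A pairing is of diagonal type if it is isomorphic to $\phi(A)$ for some diagonal integer matrix $A$ with $\det A\neq 0$. For non-zero coprime integers $b,a$, let $\phi_{b,a}$ be the pairing on $\mathbb{Z}/b$ given by $\phi_{b,a}(x,y)=axy/b \bmod \mathbb{Z}$. Proposition. Let $G$ be a finite abelian group of order $d=\prod_{i=1}^{k}p_i^{e_i}$, where $p_1,\dots,p_k$ are distinct primes and $e_i\ge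 1$ (with $k=0$ if $d=1$), and let $\nu$ be a linking pairing on $G$. Then there are finitely many (possibly zero) pairs of non-zero coprime integers $(b_j,a_j)$, $j=1,\dots,s$, such that each $b_j$ is a positive power of some $p_i$, that is, $b_j=p_i^{m}$ with $m\ge 1$, and the block sum of $\nu$ and all the $\phi_{b_j,a_j}$ is of diagonal type. -/

import Mathlib

/-- The target group `ℚ/ℤ` of linking pairings. -/
abbrev RatModInt : Type := AddCircle (1 : ℚ)

/-- Biadditive maps `G × G → ℚ/ℤ`, in curried form. -/
abbrev QZPairing (G : Type*) [AddCommGroup G] : Type _ := G →+ G →+ RatModInt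

namespace QZPairing

/-- A linking pairing: a symmetric biadditive map `ν : G × G → ℚ/ℤ` which is non-singular, that is,
whose adjoint `G → Hom(G, ℚ/ℤ)` is an isomorphism. (It is used for finite abelian groups `G`.) -/
structure IsLinkingPairing {G : Type*} [AddCommGroup G] (ν : QZPairing G) : Prop where
  symm : ∀ x y : G, ν x y = ν y x
  nonsingular : Function.Bijective (fun x : G => (ν x : G →+ RatModInt))

/-- Two pairings are isomorphic if a group isomorphism carries one to the other. -/
def Isomorphic {G H : Type*} [AddCommGroup G] [AddCommGroup H]
    (ν : QZPairing G) (μ : QZPairing H) : Prop :=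
  ∃ f : G ≃+ H, ∀ x y : G, μ (f x) (f y) = ν x y

/-- The block sum of two pairings, on `G × H`. -/
def blockSum {G H : Type*} [AddCommGroup G] [AddCommGroup H]
    (ν : QZPairing G) (μ : QZPairing H) : QZPairing (G × H) :=
  (ν.compl₂ (AddMonoidHom.fst G H)).comp (AddMonoidHom.fst G H) +
    (μ.compl₂ (AddMonoidHom.snd G H)).comp (AddMonoidHom.snd G H)

theorem blockSum_apply {G H : Type*} [AddCommGroup G] [AddCommGroup H]
    (ν : QZPairing G) (μ : QZPairing H) (x y : G × H) :
    blockSum ν μ x y = ν x.1 y.1 + μ x.2 y.2 := rfl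

/-- The block sum of a finite family of pairings, on `∏ j, G j` (the zero pairing on the trivial
group if the family is empty). -/
def blockSumFamily {ι : Type*} [Fintype ι] {G : ι → Type*} [∀ j, AddCommGroup (G j)]
    (ν : ∀ j, QZPairing (G j)) : QZPairing (∀ j, G j) :=
  ∑ j, ((ν j).compl₂ (Pi.evalAddMonoidHom G j)).comp (Pi.evalAddMonoidHom G j)

theorem blockSumFamily_apply {ι : Type*} [Fintype ι] {G : ι → Type*} [∀ j, AddCommGroup (G j)]
    (ν : ∀ j, QZPairing (G j)) (x y : ∀ j, G j) :
    blockSumFamily ν x y = ∑ j, ν j (x j) (y j) := by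
  simp [blockSumFamily, AddMonoidHom.finsetSum_apply]

/-- The pairing induced on `M ⧸ N` by a symmetric pairing on `M` that vanishes on `N × M`. -/
def quotient {M : Type*} [AddCommGroup M] (N : AddSubgroup M) (B : QZPairing M)
    (hsymm : ∀ x y : M, B x y = B y x) (hN : ∀ x ∈ N, ∀ y : M, B x y = 0) :
    QZPairing (M ⧸ N) :=
  QuotientAddGroup.lift N
    { toFun := fun x => QuotientAddGroup.lift N (B x) (fun y hy => by
        rw [AddMonoidHom.mem_ker, hsymm, hN y hy x])
      map_zero' := by
        ext y
        simp
      map_add' := fun x x' => by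
        ext y
        simp }
    (fun x hx => by
      rw [AddMonoidHom.mem_ker]
      ext y
      simp [hN x hx y])

theorem quotient_mk {M : Type*} [AddCommGroup M] (N : AddSubgroup M) (B : QZPairing M)
    (hsymm : ∀ x y : M, B x y = B y x) (hN : ∀ x ∈ N, ∀ y : M, B x y = 0) (x y : M) :
    quotient N B hsymm hN (QuotientAddGroup.mk x) (QuotientAddGroup.mk y) = B x y := rfl

end QZPairing

/-- The integer matrix `A`, viewed as a rational matrix. -/
abbrev ratMatrix {n : ℕ} (A : Matrix (Fin n) (Fin n) ℤ) : Matrix (Fin n) (Fin n) ℚ :=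
  A.map (Int.cast : ℤ → ℚ)

/-- The integer vector `v`, viewed as a rational vector. -/
abbrev ratVec {n : ℕ} (v : Fin n → ℤ) : Fin n → ℚ := fun i => (v i : ℚ)

/-- The lattice `A ℤⁿ ⊆ ℤⁿ`. -/
def imageLattice {n : ℕ} (A : Matrix (Fin n) (Fin n) ℤ) : AddSubgroup (Fin n → ℤ) :=
  A.mulVecLin.toAddMonoidHom.range

/-- The biadditive map `(v, w) ↦ vᵗ A⁻¹ w mod ℤ` on `ℤⁿ`. -/
noncomputable def matrixPrePairing {n : ℕ} (A : Matrix (Fin n) (Fin n) ℤ) : QZPairing (Fin n → ℤ) :=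
  AddMonoidHom.mk'
    (fun v => AddMonoidHom.mk'
      (fun w => ((ratVec v ⬝ᵥ (ratMatrix A)⁻¹.mulVec (ratVec w) : ℚ) : RatModInt))
      (fun w w' => by
        have h : ratVec (w + w') = ratVec w + ratVec w' := by ext i; simp [ratVec]
        rw [h, Matrix.mulVec_add, dotProduct_add, AddCircle.coe_add]))
    (fun v v' => by
      ext w
      have h : ratVec (v + v') = ratVec v + ratVec v' := by ext i; simp [ratVec]
      simp [h, add_dotProduct])

theorem matrixPrePairing_apply {n : ℕ} (A : Matrix (Fin n) (Fin n) ℤ) (v w : Fin n → ℤ) :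
    matrixPrePairing A v w =
      ((ratVec v ⬝ᵥ (ratMatrix A)⁻¹.mulVec (ratVec w) : ℚ) : RatModInt) := rfl

theorem matrixPrePairing_symm {n : ℕ} (A : Matrix (Fin n) (Fin n) ℤ) (hA : A.IsSymm)
    (v w : Fin n → ℤ) : matrixPrePairing A v w = matrixPrePairing A w v := by
  have h : (ratMatrix A)⁻¹.transpose = (ratMatrix A)⁻¹ := by
    rw [Matrix.transpose_nonsing_inv, ← Matrix.transpose_map, hA.eq]
  rw [matrixPrePairing_apply, matrixPrePairing_apply, Matrix.dotProduct_mulVec,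
    ← Matrix.mulVec_transpose, h, dotProduct_comm]

theorem matrixPrePairing_eq_zero {n : ℕ} (A : Matrix (Fin n) (Fin n) ℤ) (hA : A.IsSymm)
    (hdet : A.det ≠ 0) (v : Fin n → ℤ) (hv : v ∈ imageLattice A) (w : Fin n → ℤ) :
    matrixPrePairing A v w = 0 := by
  obtain ⟨u, rfl⟩ := hv
  rw [matrixPrePairing_symm A hA, matrixPrePairing_apply]
  have hu : IsUnit (ratMatrix A).det := by
    have : (ratMatrix A).det = (A.det : ℚ) := (Int.cast_det A).symm
    rw [this, isUnit_iff_ne_zero]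
    exact_mod_cast hdet
  have h : ratVec (A.mulVecLin.toAddMonoidHom u) = (ratMatrix A).mulVec (ratVec u) := by
    ext i
    simp [ratVec, Matrix.mulVec, dotProduct]
  rw [h, Matrix.mulVec_mulVec, Matrix.nonsing_inv_mul _ hu, Matrix.one_mulVec]
  rw [AddCircle.coe_eq_zero_iff]
  exact ⟨∑ i, w i * u i, by simp [dotProduct]⟩

/-- The pairing `φ(A)` on `ℤⁿ / A ℤⁿ`, `φ(A)(v, w) = vᵗ A⁻¹ w mod ℤ`, of a non-singular symmetric
integer matrix `A`. -/
noncomputable def matrixPairing {n : ℕ} (A : Matrix (Fin n) (Fin n) ℤ) (hA : A.IsSymm) (hdet : A.det ≠ 0) :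
    QZPairing ((Fin n → ℤ) ⧸ imageLattice A) :=
  QZPairing.quotient (imageLattice A) (matrixPrePairing A) (matrixPrePairing_symm A hA)
    (matrixPrePairing_eq_zero A hA hdet)

/-- A pairing is of diagonal type if it is isomorphic to `φ(A)` for some non-singular diagonal
integer matrix `A`. -/
def QZPairing.IsDiagonalType {G : Type*} [AddCommGroup G] (ν : QZPairing G) : Prop :=
  ∃ (n : ℕ) (A : Matrix (Fin n) (Fin n) ℤ) (hA : A.IsSymm) (hdet : A.det ≠ 0),
    A.IsDiag ∧ QZPairing.Isomorphic ν (matrixPairing A hA hdet)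

/-- The biadditive map `(x, y) ↦ a x y / b mod ℤ` on `ℤ`. -/
def cyclicPrePairing (b a : ℤ) : QZPairing ℤ :=
  AddMonoidHom.mk'
    (fun x => AddMonoidHom.mk'
      (fun y => (((a : ℚ) * x * y / b : ℚ) : RatModInt))
      (fun y y' => by
        rw [← AddCircle.coe_add]
        congr 1
        push_cast
        ring))
    (fun x x' => by
      ext
      simp only [AddMonoidHom.mk'_apply, AddMonoidHom.add_apply]
      rw [← AddCircle.coe_add]
      congr 1
      push_cast
      ring)

theorem cyclicPrePairing_apply (b a x y : ℤ) :
    cyclicPrePairing b a x y = (((a : ℚ) * x * y / b : ℚ) : RatModInt) := rfl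

theorem cyclicPrePairing_symm (b a x y : ℤ) :
    cyclicPrePairing b a x y = cyclicPrePairing b a y x := by
  rw [cyclicPrePairing_apply, cyclicPrePairing_apply, mul_right_comm]

theorem cyclicPrePairing_eq_zero (b a : ℤ) (hb : b ≠ 0) (x : ℤ)
    (hx : x ∈ AddSubgroup.zmultiples b) (y : ℤ) : cyclicPrePairing b a x y = 0 := by
  obtain ⟨k, rfl⟩ := AddSubgroup.mem_zmultiples_iff.mp hx
  have hb' : (b : ℚ) ≠ 0 := by exact_mod_cast hb
  rw [cyclicPrePairing_apply, AddCircle.coe_eq_zero_iff]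
  refine ⟨a * k * y, ?_⟩
  simp only [smul_eq_mul, zsmul_eq_mul]
  push_cast
  field_simp

/-- The pairing `φ_{b,a}` on the cyclic group `ℤ / b ℤ`, `φ_{b,a}(x, y) = a x y / b mod ℤ`,
for `b ≠ 0`. (It is non-singular exactly when `a` and `b` are coprime.) -/
def cyclicPairing (b a : ℤ) (hb : b ≠ 0) : QZPairing (ℤ ⧸ AddSubgroup.zmultiples b) :=
  QZPairing.quotient (AddSubgroup.zmultiples b) (cyclicPrePairing b a)
    (cyclicPrePairing_symm b a) (cyclicPrePairing_eq_zero b a hb)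

/-! Write ⟨a⟩ for `cyclicPairing b a`. Diagonal matrices give exactly the sums of forms ⟨1⟩ on ℤ/d
with d of either sign, and ⟨1⟩ on ℤ/(-b) is ⟨-1⟩ on ℤ/b. A cyclic form ⟨a⟩ need not be diagonal, but
⟨a⟩ ⊕ ⟨-a⟩ ≅ ⟨1⟩ ⊕ ⟨-1⟩ is (`blockSum_cyclicPairing_neg`). Hence cyclic summands of allowed order
are harmless for the stable question, whether added (`StablyDiagonal.blockSum`) or removed
(`StablyDiagonal.of_blockSum`).

It remains to peel off cyclic summands by induction on the order of G. Let p divide the order and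
let p^m be the p-part of the exponent. Some x, y killed by p^m have ν(x, y) of exact order p^m. If
an element killed by p^m has norm of exact order p^m, it spans an orthogonal summand
(`isomorphic_blockSum_cyclicPairing`). Otherwise, which by polarization happens only for p = 2,
adding one copy of ⟨1⟩ on ℤ/p^m creates two orthogonal elements of this kind
(`exists_norms_of_forall_dvd`). Either way the complement has order |G|/p^m.

Only injectivity of the adjoint is carried through the induction; it passes to orthogonal
complements. -/

namespace QZPairing

/-! ### Isomorphisms and block sums -/

namespace Isomorphic

variable {G H K L : Type*} [AddCommGroup G] [AddCommGroup H] [AddCommGroup K] [AddCommGroup L]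

theorem refl (ν : QZPairing G) : Isomorphic ν ν := ⟨AddEquiv.refl G, fun _ _ => rfl⟩

theorem symm {ν : QZPairing G} {μ : QZPairing H} (h : Isomorphic ν μ) : Isomorphic μ ν := by
  obtain ⟨f, hf⟩ := h
  exact ⟨f.symm, fun x y => by rw [← hf, f.apply_symm_apply, f.apply_symm_apply]⟩

theorem trans {ν : QZPairing G} {μ : QZPairing H} {ρ : QZPairing K} (h : Isomorphic ν μ)
    (h' : Isomorphic μ ρ) : Isomorphic ν ρ := by
  obtain ⟨f, hf⟩ := h
  obtain ⟨g, hg⟩ := h'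
  exact ⟨f.trans g, fun x y => by
    rw [AddEquiv.trans_apply, AddEquiv.trans_apply, hg, hf]⟩

theorem blockSum {ν : QZPairing G} {μ : QZPairing H} {ρ : QZPairing K} {σ : QZPairing L}
    (h : Isomorphic ν μ) (h' : Isomorphic ρ σ) :
    Isomorphic (QZPairing.blockSum ν ρ) (QZPairing.blockSum μ σ) := by
  obtain ⟨f, hf⟩ := h
  obtain ⟨g, hg⟩ := h'
  exact ⟨f.prodCongr g, fun x y => by
    rw [blockSum_apply, blockSum_apply, ← hf, ← hg]
    rfl⟩

end Isomorphic

section BlockSum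

variable {G H K : Type*} [AddCommGroup G] [AddCommGroup H] [AddCommGroup K]

theorem blockSum_assoc (ν : QZPairing G) (μ : QZPairing H) (ρ : QZPairing K) :
    Isomorphic (blockSum (blockSum ν μ) ρ) (blockSum ν (blockSum μ ρ)) :=
  ⟨AddEquiv.prodAssoc, fun x y => by
    simp only [blockSum_apply, AddEquiv.prodAssoc, AddEquiv.coe_mk, Equiv.prodAssoc_apply,
      add_assoc]⟩

theorem blockSum_comm (ν : QZPairing G) (μ : QZPairing H) :
    Isomorphic (blockSum ν μ) (blockSum μ ν) :=
  ⟨AddEquiv.prodComm, fun x y => by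
    simp only [blockSum_apply, AddEquiv.coe_prodComm, Prod.fst_swap, Prod.snd_swap, add_comm]⟩

theorem blockSumFamily_option {ι : Type*} [Fintype ι] {G : Option ι → Type*}
    [∀ j, AddCommGroup (G j)] (ν : ∀ j, QZPairing (G j)) :
    Isomorphic (blockSumFamily ν)
      (blockSum (ν none) (blockSumFamily fun j : ι => ν (some j))) :=
  ⟨{ Equiv.piOptionEquivProd with map_add' := fun _ _ => rfl }, fun x y => by
    rw [blockSumFamily_apply, Fintype.sum_option, blockSum_apply, blockSumFamily_apply]
    rfl⟩

theorem blockSumFamily_reindex {ι κ : Type*} [Fintype ι] [Fintype κ] (e : κ ≃ ι)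
    {G : ι → Type*} [∀ j, AddCommGroup (G j)] (ν : ∀ j, QZPairing (G j)) :
    Isomorphic (blockSumFamily ν) (blockSumFamily fun j : κ => ν (e j)) :=
  ⟨{ toFun := fun x j => x (e j)
     invFun := (Equiv.piCongrLeft G e)
     left_inv := fun x => (Equiv.piCongrLeft G e).apply_symm_apply x
     right_inv := fun x => (Equiv.piCongrLeft G e).symm_apply_apply x
     map_add' := fun _ _ => rfl }, fun x y => by
    rw [blockSumFamily_apply, blockSumFamily_apply]
    exact e.sum_comp fun j => ν j (x j) (y j)⟩

end BlockSum

/-! ### Nondegeneracy -/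

/-- A pairing with trivial left radical. -/
def Nondegenerate {G : Type*} [AddCommGroup G] (ν : QZPairing G) : Prop :=
  ∀ x : G, (∀ y, ν x y = 0) → x = 0

theorem IsLinkingPairing.nondegenerate {G : Type*} [AddCommGroup G] {ν : QZPairing G}
    (h : ν.IsLinkingPairing) : ν.Nondegenerate := fun x hx =>
  h.nonsingular.1 (by ext y; simp [hx])

theorem Nondegenerate.blockSum {G H : Type*} [AddCommGroup G] [AddCommGroup H]
    {ν : QZPairing G} {μ : QZPairing H} (hν : ν.Nondegenerate) (hμ : μ.Nondegenerate) :
    (QZPairing.blockSum ν μ).Nondegenerate := fun x hx =>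
  Prod.ext (hν _ fun y => by simpa [blockSum_apply] using hx (y, 0))
    (hμ _ fun y => by simpa [blockSum_apply] using hx (0, y))

/-- A form-preserving homomorphism out of a nondegenerate pairing is injective. -/
theorem Nondegenerate.injective {G H : Type*} [AddCommGroup G] [AddCommGroup H]
    {ν : QZPairing G} {μ : QZPairing H} (hν : ν.Nondegenerate) (f : G →+ H)
    (hf : ∀ x y, μ (f x) (f y) = ν x y) : Function.Injective f :=
  (injective_iff_map_eq_zero f).2 fun x hx => hν x fun y => by simp [← hf, hx]

end QZPairing

open QZPairing

/-! ### Cyclic pairings and fractions modulo ℤ -/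

theorem cyclicPairing_mk (b a : ℤ) (hb : b ≠ 0) (s t : ℤ) :
    cyclicPairing b a hb (QuotientAddGroup.mk s) (QuotientAddGroup.mk t) =
      (s * t) • (((a : ℚ) / b : ℚ) : RatModInt) := by
  change cyclicPrePairing b a s t = _
  rw [cyclicPrePairing_apply, ← AddCircle.coe_zsmul]
  congr 1
  simp only [zsmul_eq_mul]
  push_cast
  ring

theorem coe_div_eq_zero_iff (a b : ℤ) (hb : b ≠ 0) :
    (((a : ℚ) / b : ℚ) : RatModInt) = 0 ↔ b ∣ a := by
  have hb' : (b : ℚ) ≠ 0 := by exact_mod_cast hb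
  rw [AddCircle.coe_eq_zero_iff]
  constructor
  · rintro ⟨n, hn⟩
    refine ⟨n, ?_⟩
    rw [zsmul_eq_mul, mul_one, eq_div_iff hb'] at hn
    rw [mul_comm]
    exact_mod_cast hn.symm
  · rintro ⟨n, rfl⟩
    refine ⟨n, ?_⟩
    push_cast
    rw [zsmul_eq_mul, mul_one]
    field_simp

theorem zsmul_coe_div (n a b : ℤ) :
    n • (((a : ℚ) / b : ℚ) : RatModInt) = ((((n * a : ℤ) : ℚ) / b : ℚ) : RatModInt) := by
  rw [← AddCircle.coe_zsmul, zsmul_eq_mul]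
  congr 1
  push_cast
  ring

theorem coe_div_eq_iff (a c b : ℤ) (hb : b ≠ 0) :
    (((a : ℚ) / b : ℚ) : RatModInt) = (((c : ℚ) / b : ℚ) : RatModInt) ↔ b ∣ a - c := by
  rw [← coe_div_eq_zero_iff _ _ hb, ← sub_eq_zero, ← AddCircle.coe_sub]
  push_cast
  rw [sub_div]

theorem exists_eq_coe_div {b : ℤ} (hb : b ≠ 0) (q : RatModInt) (hq : b • q = 0) :
    ∃ c : ℤ, q = (((c : ℚ) / b : ℚ) : RatModInt) := by
  obtain ⟨r, rfl⟩ := QuotientAddGroup.mk_surjective q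
  have hb' : (b : ℚ) ≠ 0 := by exact_mod_cast hb
  have h : ((b • r : ℚ) : RatModInt) = 0 := hq
  rw [AddCircle.coe_eq_zero_iff] at h
  obtain ⟨n, hn⟩ := h
  refine ⟨n, congrArg _ ?_⟩
  simp only [zsmul_eq_mul, mul_one] at hn
  rw [hn]
  field_simp

theorem cyclicPairing_nondegenerate {b a : ℤ} (hb : b ≠ 0) (h : IsCoprime b a) :
    (cyclicPairing b a hb).Nondegenerate := by
  intro x hx
  obtain ⟨s, rfl⟩ := QuotientAddGroup.mk_surjective x
  have := hx (QuotientAddGroup.mk 1)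
  rw [cyclicPairing_mk, mul_one, zsmul_coe_div, coe_div_eq_zero_iff _ _ hb] at this
  rw [QuotientAddGroup.eq_zero_iff, Int.mem_zmultiples_iff]
  exact h.dvd_of_dvd_mul_right this

/-- The homomorphism `ℤ / b → G` sending `1` to a given element killed by `b`. -/
def cyclicLift {G : Type*} [AddCommGroup G] (b : ℤ) (z : G) (hz : b • z = 0) :
    ℤ ⧸ AddSubgroup.zmultiples b →+ G :=
  QuotientAddGroup.lift _ (zmultiplesHom G z) (fun x hx => by
    obtain ⟨k, rfl⟩ := AddSubgroup.mem_zmultiples_iff.mp hx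
    simp [mul_smul, hz])

theorem cyclicLift_mk {G : Type*} [AddCommGroup G] (b : ℤ) (z : G) (hz : b • z = 0) (s : ℤ) :
    cyclicLift b z hz (QuotientAddGroup.mk s) = s • z := rfl

instance finite_quotient_zmultiples (b : ℤ) [NeZero b] :
    Finite (ℤ ⧸ AddSubgroup.zmultiples b) := by
  have : NeZero b.natAbs := ⟨Int.natAbs_ne_zero.2 (NeZero.ne b)⟩
  exact Finite.of_equiv _ (Int.quotientZMultiplesEquivZMod b).symm.toEquiv

theorem card_quotient_zmultiples (b : ℤ) :
    Nat.card (ℤ ⧸ AddSubgroup.zmultiples b) = b.natAbs := by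
  rw [Nat.card_congr (Int.quotientZMultiplesEquivZMod b).toEquiv, Nat.card_zmod]

/-! ### Splitting off an orthogonal cyclic summand -/

namespace QZPairing

theorem map_zsmul_zsmul {G : Type*} [AddCommGroup G] (ν : QZPairing G) (s t : ℤ) (x y : G) :
    ν (s • x) (t • y) = (s * t) • ν x y := by
  rw [map_zsmul, map_zsmul, AddMonoidHom.zsmul_apply, ← mul_smul, mul_comm]

/-- The restriction of a pairing to a subgroup. -/
def restrict {G : Type*} [AddCommGroup G] (ν : QZPairing G) (H : AddSubgroup G) : QZPairing H :=
  (ν.compl₂ H.subtype).comp H.subtype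

theorem restrict_apply {G : Type*} [AddCommGroup G] (ν : QZPairing G) (H : AddSubgroup G)
    (x y : H) : ν.restrict H x y = ν x y := rfl

section Split

variable {G : Type*} [AddCommGroup G] {ν : QZPairing G} (hs : ∀ x y, ν x y = ν y x)
  {b a : ℤ} (hb : b ≠ 0) (hab : IsCoprime b a) {z : G} (hz : b • z = 0)
  (hzz : ν z z = (((a : ℚ) / b : ℚ) : RatModInt))

include hb hab hz hzz

/-- Orthogonal projection along z: the norm numerator a is invertible modulo b, so the coefficient
is the numerator of ν(z, w) times that inverse. -/
theorem exists_sub_zsmul_mem_ker (w : G) : ∃ c : ℤ, w - c • z ∈ (ν z).ker := by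
  obtain ⟨c, hc⟩ := exists_eq_coe_div hb (ν z w) (by
    rw [← AddMonoidHom.zsmul_apply, ← map_zsmul, hz, map_zero, AddMonoidHom.zero_apply])
  obtain ⟨u, v, huv⟩ := hab
  refine ⟨c * v, ?_⟩
  rw [AddMonoidHom.mem_ker, map_sub, map_zsmul, hzz, hc, zsmul_coe_div, sub_eq_zero,
    coe_div_eq_iff _ _ _ hb]
  exact ⟨c * u, by linear_combination -c * huv⟩

include hs

/-- A cyclic subgroup on which the pairing is nondegenerate is an orthogonal summand. -/
theorem isomorphic_blockSum_cyclicPairing (hν : ν.Nondegenerate) :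
    (ν.restrict (ν z).ker).Nondegenerate ∧
    Isomorphic (blockSum (ν.restrict (ν z).ker) (cyclicPairing b a hb)) ν := by
  have hnd : (ν.restrict (ν z).ker).Nondegenerate := by
    intro x hx
    -- Moving w into the complement by a multiple of z does not change its pairing with x, as x is
    -- orthogonal to z.
    refine Subtype.ext (hν x fun w => ?_)
    obtain ⟨c, hc⟩ := exists_sub_zsmul_mem_ker hb hab hz hzz w
    have h1 := hx ⟨_, hc⟩
    have h2 : ν x z = 0 := by rw [hs]; exact x.2
    rw [restrict_apply, map_sub, map_zsmul, h2, smul_zero, sub_zero] at h1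
    exact h1
  refine ⟨hnd, ?_⟩
  let f : (ν z).ker × (ℤ ⧸ AddSubgroup.zmultiples b) →+ G :=
    (ν z).ker.subtype.coprod (cyclicLift b z hz)
  have hf : ∀ x y, ν (f x) (f y) =
      blockSum (ν.restrict (ν z).ker) (cyclicPairing b a hb) x y := by
    rintro ⟨x, s⟩ ⟨y, t⟩
    obtain ⟨s, rfl⟩ := QuotientAddGroup.mk_surjective s
    obtain ⟨t, rfl⟩ := QuotientAddGroup.mk_surjective t
    have hx : ν x z = 0 := by rw [hs]; exact x.2
    have hy : ν z y = 0 := y.2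
    simp only [f, AddMonoidHom.coprod_apply, cyclicLift_mk, blockSum_apply, cyclicPairing_mk,
      restrict_apply, ← hzz, map_add, AddMonoidHom.add_apply, map_zsmul_zsmul,
      AddSubgroup.subtype_apply]
    simp [map_zsmul, hx, hy]
  refine ⟨AddEquiv.ofBijective f
    ⟨(hnd.blockSum (cyclicPairing_nondegenerate hb hab)).injective f hf, fun w => ?_⟩, hf⟩
  obtain ⟨c, hc⟩ := exists_sub_zsmul_mem_ker hb hab hz hzz w
  exact ⟨(⟨_, hc⟩, QuotientAddGroup.mk c), by
    simp only [f, AddMonoidHom.coprod_apply, cyclicLift_mk, AddSubgroup.subtype_apply,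
      sub_add_cancel]⟩

end Split

end QZPairing

/-! ### Cancelling a cyclic form against its negative -/

theorem cyclicPairing_add_mul (b a k : ℤ) (hb : b ≠ 0) :
    cyclicPairing b (a + k * b) hb = cyclicPairing b a hb := by
  refine AddMonoidHom.ext fun x => AddMonoidHom.ext fun y => ?_
  obtain ⟨s, rfl⟩ := QuotientAddGroup.mk_surjective x
  obtain ⟨t, rfl⟩ := QuotientAddGroup.mk_surjective y
  rw [cyclicPairing_mk, cyclicPairing_mk]
  congr 1
  rw [coe_div_eq_iff _ _ _ hb]
  exact ⟨k, by ring⟩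

/-- Every odd number is a difference of consecutive squares. If a is even, coprimality makes b odd,
so a + b is odd. -/
theorem exists_add_mul_eq_sq_sub_sq {b a : ℤ} (h : IsCoprime b a) :
    ∃ k x y : ℤ, a + k * b = x ^ 2 - y ^ 2 := by
  have key : ∃ k : ℤ, Odd (a + k * b) := by
    rcases Int.even_or_odd a with ha | ha
    · refine ⟨1, ?_⟩
      rcases Int.even_or_odd b with hb | hb
      · exact absurd (h.isUnit_of_dvd' hb.two_dvd ha.two_dvd) (by decide)
      · rw [one_mul]; exact ha.add_odd hb
    · exact ⟨0, by simpa using ha⟩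
  obtain ⟨k, c, hc⟩ := key
  exact ⟨k, c + 1, c, by rw [hc]; ring⟩

/-- The form `⟨a⟩ ⊕ ⟨-a⟩` over `ℤ / b` is isomorphic to `⟨1⟩ ⊕ ⟨-1⟩`. -/
theorem blockSum_cyclicPairing_neg {b a : ℤ} (hb : b ≠ 0) (h : IsCoprime b a) :
    Isomorphic (blockSum (cyclicPairing b a hb) (cyclicPairing b (-a) hb))
      (blockSum (cyclicPairing b 1 hb) (cyclicPairing (-b) 1 (neg_ne_zero.2 hb))) := by
  obtain ⟨k, x, y, hk⟩ := exists_add_mul_eq_sq_sub_sq h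
  have e1 : cyclicPairing b a hb = cyclicPairing b (x ^ 2 - y ^ 2) hb := by
    rw [← hk, cyclicPairing_add_mul]
  have e2 : cyclicPairing b (-a) hb = cyclicPairing b (-(x ^ 2 - y ^ 2)) hb := by
    rw [← hk, neg_add, ← neg_mul, cyclicPairing_add_mul]
  have hnd := (cyclicPairing_nondegenerate hb h).blockSum
    (cyclicPairing_nondegenerate hb h.neg_right)
  rw [e1, e2] at hnd ⊢
  let T := (ℤ ⧸ AddSubgroup.zmultiples b) × (ℤ ⧸ AddSubgroup.zmultiples (-b))
  have hT : ∀ s t : ℤ, b • ((QuotientAddGroup.mk s, QuotientAddGroup.mk t) : T) = 0 := by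
    intro s t
    refine Prod.ext ?_ ?_
    · change ((b • s : ℤ) : ℤ ⧸ AddSubgroup.zmultiples b) = 0
      rw [QuotientAddGroup.eq_zero_iff, Int.mem_zmultiples_iff]
      exact ⟨s, by simp⟩
    · change ((b • t : ℤ) : ℤ ⧸ AddSubgroup.zmultiples (-b)) = 0
      rw [QuotientAddGroup.eq_zero_iff, Int.mem_zmultiples_iff]
      exact ⟨-t, by simp⟩
  -- In ⟨1⟩ ⊕ ⟨-1⟩ the vectors (x, y) and (y, x) are orthogonal, with norm numerators x² - y² and y²
  -- - x². Nondegeneracy then makes the map injective, and the orders agree.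
  let f := (cyclicLift b _ (hT x y)).coprod (cyclicLift b _ (hT y x))
  have hf : ∀ u v, blockSum (cyclicPairing b 1 hb) (cyclicPairing (-b) 1 (neg_ne_zero.2 hb))
      (f u) (f v) = blockSum (cyclicPairing b (x ^ 2 - y ^ 2) hb)
        (cyclicPairing b (-(x ^ 2 - y ^ 2)) hb) u v := by
    rintro ⟨u, u'⟩ ⟨v, v'⟩
    obtain ⟨u, rfl⟩ := QuotientAddGroup.mk_surjective u
    obtain ⟨u', rfl⟩ := QuotientAddGroup.mk_surjective u'
    obtain ⟨v, rfl⟩ := QuotientAddGroup.mk_surjective v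
    obtain ⟨v', rfl⟩ := QuotientAddGroup.mk_surjective v'
    have hfm : ∀ s t : ℤ, f (QuotientAddGroup.mk s, QuotientAddGroup.mk t) =
        (QuotientAddGroup.mk (s * x + t * y), QuotientAddGroup.mk (s * y + t * x)) :=
      fun s t => rfl
    rw [hfm, hfm, blockSum_apply, blockSum_apply]
    simp only [cyclicPairing_mk, zsmul_coe_div, ← AddCircle.coe_add]
    congr 1
    have hb' : (b : ℚ) ≠ 0 := by exact_mod_cast hb
    push_cast
    field_simp
    ring
  have : NeZero b := ⟨hb⟩
  have : NeZero (-b) := ⟨neg_ne_zero.2 hb⟩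
  refine ⟨AddEquiv.ofBijective f ?_, hf⟩
  rw [Nat.bijective_iff_injective_and_card]
  refine ⟨hnd.injective f hf, ?_⟩
  simp [Nat.card_prod, card_quotient_zmultiples]

/-! ### Diagonal matrices as sums of forms ⟨1⟩ -/

theorem QZPairing.IsDiagonalType.of_isomorphic {G : Type*} [AddCommGroup G] {ν : QZPairing G}
    {n : ℕ} (d : Fin n → ℤ) (hd : ∀ j, d j ≠ 0)
    (h : Isomorphic ν (blockSumFamily fun j => cyclicPairing (d j) 1 (hd j))) :
    ν.IsDiagonalType := by
  have hdet : (Matrix.diagonal d).det ≠ 0 := by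
    rw [Matrix.det_diagonal]
    exact Finset.prod_ne_zero_iff.2 fun j _ => hd j
  refine ⟨n, Matrix.diagonal d, Matrix.isSymm_diagonal d, hdet, Matrix.isDiag_diagonal d,
    h.trans (Isomorphic.symm ?_)⟩
  -- Coordinatewise reduction, whose kernel is the image lattice of the diagonal matrix.
  let g : (Fin n → ℤ) →+ ∀ j, ℤ ⧸ AddSubgroup.zmultiples (d j) :=
    AddMonoidHom.pi fun j => (QuotientAddGroup.mk' _).comp (Pi.evalAddMonoidHom _ j)
  have hker : imageLattice (Matrix.diagonal d) = g.ker := by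
    ext v
    rw [AddMonoidHom.mem_ker, funext_iff]
    have : ∀ j, g v j = 0 ↔ d j ∣ v j := fun j => by
      rw [← Int.mem_zmultiples_iff, ← QuotientAddGroup.eq_zero_iff]
      rfl
    simp only [Pi.zero_apply, this]
    constructor
    · rintro ⟨u, rfl⟩ j
      exact ⟨u j, by simp [Matrix.mulVec_diagonal]⟩
    · intro hv
      choose u hu using hv
      exact ⟨u, by ext j; simp [Matrix.mulVec_diagonal, hu]⟩
  have hg : Function.Surjective g := fun w => by
    choose v hv using fun j => QuotientAddGroup.mk_surjective (w j)
    exact ⟨v, funext hv⟩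
  refine ⟨(QuotientAddGroup.quotientAddEquivOfEq hker).trans
    (QuotientAddGroup.quotientKerEquivOfSurjective g hg), fun x y => ?_⟩
  obtain ⟨v, rfl⟩ := QuotientAddGroup.mk_surjective x
  obtain ⟨w, rfl⟩ := QuotientAddGroup.mk_surjective y
  change blockSumFamily _ (g v) (g w) = matrixPrePairing (Matrix.diagonal d) v w
  have hinv : (ratMatrix (Matrix.diagonal d))⁻¹ = Matrix.diagonal fun j => ((d j : ℚ))⁻¹ := by
    refine Matrix.inv_eq_left_inv ?_
    rw [ratMatrix, Matrix.diagonal_map (by simp), Matrix.diagonal_mul_diagonal,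
      ← Matrix.diagonal_one]
    congr 1
    funext j
    exact inv_mul_cancel₀ (by exact_mod_cast hd j)
  rw [blockSumFamily_apply, matrixPrePairing_apply, hinv]
  have : ∀ j, cyclicPairing (d j) 1 (hd j) (g v j) (g w j) =
      ((ratVec v j * ((d j : ℚ)⁻¹ * ratVec w j) : ℚ) : RatModInt) := fun j => by
    refine (cyclicPairing_mk (d j) 1 (hd j) (v j) (w j)).trans ?_
    rw [zsmul_coe_div]
    congr 1
    push_cast
    ring
  simp only [this, dotProduct, Matrix.mulVec_diagonal]
  exact (map_sum (QuotientAddGroup.mk' (AddSubgroup.zmultiples (1 : ℚ))) _ _).symm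

/-! ### Stable diagonality -/

namespace QZPairing

/-- A pairing that becomes a sum of forms `⟨1⟩` on cyclic groups after adding finitely many
nondegenerate cyclic pairings whose orders are powers of primes in `S`. -/
def StablyDiagonal (S : Set ℕ) {G : Type*} [AddCommGroup G] (ν : QZPairing G) : Prop :=
  ∃ (ι : Type) (_ : Fintype ι) (b a : ι → ℤ) (hb : ∀ j, b j ≠ 0),
    (∀ j, IsCoprime (b j) (a j)) ∧ (∀ j, ∃ p ∈ S, ∃ m : ℕ, 0 < m ∧ b j = (p : ℤ) ^ m) ∧
    ∃ (κ : Type) (_ : Fintype κ) (d : κ → ℤ) (hd : ∀ j, d j ≠ 0),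
      Isomorphic (blockSum ν (blockSumFamily fun j => cyclicPairing (b j) (a j) (hb j)))
        (blockSumFamily fun j => cyclicPairing (d j) 1 (hd j))

namespace StablyDiagonal

variable {S : Set ℕ} {G H : Type*} [AddCommGroup G] [AddCommGroup H]

theorem congr {ν : QZPairing G} {μ : QZPairing H} (h : StablyDiagonal S ν)
    (e : Isomorphic ν μ) : StablyDiagonal S μ := by
  obtain ⟨ι, hι, b, a, hb, hab, hS, κ, hκ, d, hd, hi⟩ := h
  exact ⟨ι, hι, b, a, hb, hab, hS, κ, hκ, d, hd,
    (Isomorphic.blockSum e.symm (Isomorphic.refl _)).trans hi⟩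

theorem of_subsingleton [Subsingleton G] (ν : QZPairing G) : StablyDiagonal S ν :=
  ⟨Empty, inferInstance, nofun, nofun, nofun, nofun, nofun, Empty, inferInstance, nofun, nofun,
    { toFun := 0, invFun := 0, left_inv := fun _ => Subsingleton.elim _ _,
      right_inv := fun _ => Subsingleton.elim _ _, map_add' := fun _ _ => Subsingleton.elim _ _ },
    fun x y => by
      rw [Subsingleton.elim x 0, map_zero, map_zero]
      simp⟩

theorem forall_option_elim {ι : Type} {P : ℤ → ℤ → Prop} {b₀ a₀ : ℤ} {b a : ι → ℤ}
    (h₀ : P b₀ a₀) (h : ∀ j, P (b j) (a j)) (o : Option ι) :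
    P (o.elim b₀ b) (o.elim a₀ a) := by
  cases o
  exacts [h₀, h _]

theorem of_blockSum {ν : QZPairing G} {p m : ℕ} (hp : p ∈ S) (hm : 0 < m) {b a : ℤ}
    (hb : b ≠ 0) (hbp : b = (p : ℤ) ^ m) (hab : IsCoprime b a)
    (h : StablyDiagonal S (blockSum ν (cyclicPairing b a hb))) : StablyDiagonal S ν := by
  obtain ⟨ι, hι, c, f, hc, hcf, hS, κ, hκ, d, hd, hi⟩ := h
  refine ⟨Option ι, inferInstance, fun o => o.elim b c, fun o => o.elim a f,
    forall_option_elim (P := fun b _ => b ≠ 0) (a₀ := a) (a := f) hb hc,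
    forall_option_elim (P := fun b a => IsCoprime b a) hab hcf,
    forall_option_elim (P := fun b _ => ∃ p ∈ S, ∃ m : ℕ, 0 < m ∧ b = (p : ℤ) ^ m)
      (a₀ := a) (a := f) ⟨p, hp, m, hm, hbp⟩ hS, κ, hκ, d, hd, ?_⟩
  refine (Isomorphic.blockSum (Isomorphic.refl ν) (blockSumFamily_option _)).trans ?_
  exact (blockSum_assoc _ _ _).symm.trans hi

/-- Stabilizing further by ⟨-a⟩ turns the new summand into ⟨a⟩ ⊕ ⟨-a⟩, which contributes the two
diagonal entries b and -b. -/
theorem blockSum {ν : QZPairing G} {p m : ℕ} (hp : p ∈ S) (hm : 0 < m) {b a : ℤ}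
    (hb : b ≠ 0) (hbp : b = (p : ℤ) ^ m) (hab : IsCoprime b a)
    (h : StablyDiagonal S ν) : StablyDiagonal S (QZPairing.blockSum ν (cyclicPairing b a hb)) := by
  refine of_blockSum hp hm hb hbp hab.neg_right ?_
  obtain ⟨ι, hι, c, f, hc, hcf, hS, κ, hκ, d, hd, hi⟩ := h
  have hb' : -b ≠ 0 := neg_ne_zero.2 hb
  have hd' := forall_option_elim (P := fun b _ => b ≠ 0) (a₀ := 1) (a := 1) hb' hd
  have hd'' := forall_option_elim (P := fun b _ => b ≠ 0) (a₀ := 1) (a := 1) hb hd'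
  refine ⟨ι, hι, c, f, hc, hcf, hS, Option (Option κ), inferInstance,
    fun o => o.elim b fun o => o.elim (-b) d, hd'', ?_⟩
  -- Regroup as (⟨a⟩ ⊕ ⟨-a⟩) ⊕ (ν ⊕ F), where F is the family that stabilizes ν.
  refine Isomorphic.trans (Isomorphic.blockSum
    ((blockSum_assoc _ _ _).trans (blockSum_comm _ _)) (Isomorphic.refl _)) ?_
  refine Isomorphic.trans ((blockSum_assoc _ _ _).trans
    (Isomorphic.blockSum (blockSum_cyclicPairing_neg hb hab) hi)) ?_
  refine (blockSum_assoc _ _ _).trans (Isomorphic.symm ?_)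
  refine (blockSumFamily_option _).trans ?_
  exact Isomorphic.blockSum (Isomorphic.refl _) (blockSumFamily_option _)

theorem isDiagonalType {ν : QZPairing G} (h : StablyDiagonal S ν) :
    ∃ (s : ℕ) (b a : Fin s → ℤ) (hb : ∀ j, b j ≠ 0),
      (∀ j, IsCoprime (b j) (a j)) ∧
      (∀ j, ∃ p ∈ S, ∃ m : ℕ, 0 < m ∧ b j = (p : ℤ) ^ m) ∧
      (QZPairing.blockSum ν
        (blockSumFamily fun j => cyclicPairing (b j) (a j) (hb j))).IsDiagonalType := by
  obtain ⟨ι, _, b, a, hb, hab, hS, κ, _, d, hd, hi⟩ := h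
  let e := (Fintype.equivFin ι).symm
  let e' := (Fintype.equivFin κ).symm
  refine ⟨_, b ∘ e, a ∘ e, fun j => hb _, fun j => hab _, fun j => hS _,
    IsDiagonalType.of_isomorphic (d ∘ e') (fun j => hd _) ?_⟩
  refine Isomorphic.trans (Isomorphic.blockSum (Isomorphic.refl ν)
    (blockSumFamily_reindex e fun j => cyclicPairing (b j) (a j) (hb j)).symm) ?_
  exact hi.trans (blockSumFamily_reindex e' fun j => cyclicPairing (d j) 1 (hd j))

end StablyDiagonal

/-! ### Elements whose norm has exact order p^m -/

theorem blockSum_symm {G H : Type*} [AddCommGroup G] [AddCommGroup H]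
    {ν : QZPairing G} {μ : QZPairing H} (hν : ∀ x y, ν x y = ν y x)
    (hμ : ∀ x y, μ x y = μ y x) (x y : G × H) : blockSum ν μ x y = blockSum ν μ y x := by
  rw [blockSum_apply, blockSum_apply, hν, hμ]

theorem zsmul_apply_eq_zero {G : Type*} [AddCommGroup G] (ν : QZPairing G) {b : ℤ} {x : G}
    (hx : b • x = 0) (y : G) : b • ν x y = 0 := by
  rw [← AddMonoidHom.zsmul_apply, ← map_zsmul, hx, map_zero, AddMonoidHom.zero_apply]

end QZPairing

theorem cyclicPairing_symm (b a : ℤ) (hb : b ≠ 0) (x y : ℤ ⧸ AddSubgroup.zmultiples b) :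
    cyclicPairing b a hb x y = cyclicPairing b a hb y x := by
  obtain ⟨s, rfl⟩ := QuotientAddGroup.mk_surjective x
  obtain ⟨t, rfl⟩ := QuotientAddGroup.mk_surjective y
  rw [cyclicPairing_mk, cyclicPairing_mk, mul_comm]

theorem isCoprime_prime_pow_of_not_dvd {p : ℕ} (hp : p.Prime) (m : ℕ) {c : ℤ}
    (h : ¬ (p : ℤ) ∣ c) : IsCoprime ((p : ℤ) ^ m) c :=
  ((Nat.prime_iff_prime_int.1 hp).coprime_iff_not_dvd.2 h).pow_left

namespace QZPairing

/-- A finite group with a nondegenerate pairing whose order is divisible by `p` contains elements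
`x, y` killed by some `p ^ m` with `ν x y` of exact order `p ^ m`. -/
theorem Nondegenerate.exists_apply_eq_coe_div {G : Type*} [AddCommGroup G] [Finite G]
    {ν : QZPairing G} (hν : ν.Nondegenerate) {p : ℕ} (hp : p.Prime) (hpG : p ∣ Nat.card G) :
    ∃ (m : ℕ) (x y : G) (v : ℤ), 0 < m ∧ ((p : ℤ) ^ m) • x = 0 ∧ ((p : ℤ) ^ m) • y = 0 ∧
      ¬ (p : ℤ) ∣ v ∧ ν x y = (((v : ℚ) / ((p : ℤ) ^ m : ℤ) : ℚ) : RatModInt) := by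
  have := Fact.mk hp
  obtain ⟨g, hg⟩ := AddMonoid.exists_addOrderOf_eq_exponent
    (AddMonoid.ExponentExists.of_finite (G := G))
  have hpos : AddMonoid.exponent G ≠ 0 := AddMonoid.exponent_ne_zero_of_finite
  have hpe : p ∣ AddMonoid.exponent G := by
    obtain ⟨t, ht⟩ := exists_prime_addOrderOf_dvd_card' p hpG
    exact ht ▸ AddMonoid.addOrder_dvd_exponent t
  obtain ⟨m, N, hN, hmN⟩ := Nat.exists_eq_pow_mul_and_not_dvd hpos p hp.ne_one
  have hm : 0 < m := by
    rcases Nat.eq_zero_or_pos m with rfl | hm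
    · rw [hmN, pow_zero, one_mul] at hpe
      exact absurd hpe hN
    · exact hm
  have hkill : ∀ w : G, ((p : ℤ) ^ m) • ((N : ℤ) • w) = 0 := fun w => by
    have := AddMonoid.exponent_nsmul_eq_zero (G := G) w
    rw [hmN] at this
    rw [← mul_smul]
    exact_mod_cast this
  have hb : ((p : ℤ) ^ m) ≠ 0 := pow_ne_zero _ (by exact_mod_cast hp.ne_zero)
  have hx : ((p : ℤ) ^ (m - 1)) • ((N : ℤ) • g) ≠ 0 := by
    intro h
    rw [← mul_smul] at h
    have h' : (p ^ (m - 1) * N) • g = 0 := by exact_mod_cast h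
    have hN0 : 0 < N := Nat.pos_of_ne_zero (by rintro rfl; simp at hN)
    have h1 := addOrderOf_dvd_of_nsmul_eq_zero h'
    rw [hg, hmN] at h1
    have h2 := Nat.dvd_of_mul_dvd_mul_right hN0 h1
    have h3 := (Nat.pow_dvd_pow_iff_le_right hp.one_lt).1 h2
    omega
  -- The element N • g has order exactly p^m, so nondegeneracy detects its multiple by p^(m-1). This
  -- prevents p from dividing the numerator c below.
  obtain ⟨y, hy⟩ : ∃ y, ν (((p : ℤ) ^ (m - 1)) • ((N : ℤ) • g)) y ≠ 0 := by
    by_contra! h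
    exact hx (hν _ h)
  obtain ⟨c, hc⟩ := exists_eq_coe_div hb _ (ν.zsmul_apply_eq_zero (hkill g) y)
  have hpc : ¬ (p : ℤ) ∣ c := by
    rintro ⟨c', rfl⟩
    refine hy ?_
    rw [map_zsmul, AddMonoidHom.zsmul_apply, hc, zsmul_coe_div, coe_div_eq_zero_iff _ _ hb,
      ← mul_assoc, ← pow_succ, Nat.sub_add_cancel hm]
    exact dvd_mul_right _ _
  -- The factor N makes y killed by p^m and, being prime to p, keeps the numerator prime to p.
  refine ⟨m, (N : ℤ) • g, (N : ℤ) • y, N * c, hm, hkill g, hkill y, ?_, ?_⟩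
  · rw [(Nat.prime_iff_prime_int.1 hp).dvd_mul]
    rintro (h | h)
    exacts [hN (by exact_mod_cast h), hpc h]
  · rw [map_zsmul, hc, zsmul_coe_div]

/-- After adding `⟨1⟩` on `ℤ / p ^ m`, a nondegenerate pairing in which no element killed by `p ^ m`
has a norm of exact order `p ^ m` acquires two such orthogonal elements. -/
theorem exists_norms_of_forall_dvd {G : Type*} [AddCommGroup G] {ν : QZPairing G}
    (hs : ∀ x y, ν x y = ν y x) {p m : ℕ} (hp : p.Prime) (hb : ((p : ℤ) ^ m) ≠ 0) {x y : G}
    {v : ℤ} (hm : 0 < m) (hx : ((p : ℤ) ^ m) • x = 0) (hy : ((p : ℤ) ^ m) • y = 0)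
    (hv : ¬ (p : ℤ) ∣ v) (hxy : ν x y = (((v : ℚ) / ((p : ℤ) ^ m : ℤ) : ℚ) : RatModInt))
    (h : ∀ (z : G) (c : ℤ), ((p : ℤ) ^ m) • z = 0 →
      ν z z = (((c : ℚ) / ((p : ℤ) ^ m : ℤ) : ℚ) : RatModInt) → (p : ℤ) ∣ c) :
    ∃ (z w : G × (ℤ ⧸ AddSubgroup.zmultiples ((p : ℤ) ^ m))) (c c' : ℤ),
      ((p : ℤ) ^ m) • z = 0 ∧ ((p : ℤ) ^ m) • w = 0 ∧ ¬ (p : ℤ) ∣ c ∧ ¬ (p : ℤ) ∣ c' ∧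
      blockSum ν (cyclicPairing _ 1 hb) z z =
        (((c : ℚ) / ((p : ℤ) ^ m : ℤ) : ℚ) : RatModInt) ∧
      blockSum ν (cyclicPairing _ 1 hb) w w =
        (((c' : ℚ) / ((p : ℤ) ^ m : ℤ) : ℚ) : RatModInt) ∧
      blockSum ν (cyclicPairing _ 1 hb) z w = 0 := by
  have hpp := Nat.prime_iff_prime_int.1 hp
  set b : ℤ := (p : ℤ) ^ m with hbdef
  have hpb : (p : ℤ) ∣ b := dvd_pow_self _ hm.ne'
  obtain ⟨α, hα⟩ := exists_eq_coe_div hb _ (ν.zsmul_apply_eq_zero hx x)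
  obtain ⟨β, hβ⟩ := exists_eq_coe_div hb _ (ν.zsmul_apply_eq_zero hy y)
  have hpα := h x α hx hα
  have hpβ := h y β hy hβ
  have hc : ¬ (p : ℤ) ∣ α + 1 := fun h' =>
    hpp.not_dvd_one ((dvd_add_right hpα).1 h')
  -- Since p divides α, the norm numerator α + 1 of (x, 1) is a unit modulo b, with inverse t.
  obtain ⟨r, t, hrt⟩ := isCoprime_prime_pow_of_not_dvd hp m hc
  rw [← hbdef] at hrt
  have hpt : ¬ (p : ℤ) ∣ t := fun h' => hpp.not_dvd_one (by
    rw [← hrt]; exact dvd_add (hpb.mul_left _) (h'.mul_right _))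
  let μ := blockSum ν (cyclicPairing b 1 hb)
  let z : G × (ℤ ⧸ AddSubgroup.zmultiples b) := (x, QuotientAddGroup.mk 1)
  let y' : G × (ℤ ⧸ AddSubgroup.zmultiples b) := (y, 0)
  have hsμ : ∀ u w, μ u w = μ w u := blockSum_symm hs (cyclicPairing_symm b 1 hb)
  have hz : b • z = 0 := by
    refine Prod.ext hx ?_
    change ((b • (1 : ℤ) : ℤ) : ℤ ⧸ AddSubgroup.zmultiples b) = 0
    rw [QuotientAddGroup.eq_zero_iff, Int.mem_zmultiples_iff]
    simp
  have hy' : b • y' = 0 := Prod.ext hy (smul_zero _)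
  have hzz : μ z z = ((((α + 1 : ℤ) : ℚ) / b : ℚ) : RatModInt) := by
    change ν x x + cyclicPairing b 1 hb (QuotientAddGroup.mk 1) (QuotientAddGroup.mk 1) = _
    rw [cyclicPairing_mk, hα, zsmul_coe_div, ← AddCircle.coe_add]
    congr 1
    push_cast
    ring
  have hzy : μ z y' = (((v : ℚ) / b : ℚ) : RatModInt) := by
    change ν x y + cyclicPairing b 1 hb (QuotientAddGroup.mk 1)
      (0 : ℤ ⧸ AddSubgroup.zmultiples b) = _
    rw [map_zero, add_zero, hxy]
  have hyy : μ y' y' = (((β : ℚ) / b : ℚ) : RatModInt) := by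
    change ν y y + cyclicPairing b 1 hb 0 (0 : ℤ ⧸ AddSubgroup.zmultiples b) = _
    rw [map_zero, add_zero, hβ]
  have hort : μ z (y' - (t * v) • z) = 0 := by
    rw [map_sub, map_zsmul, hzz, hzy, zsmul_coe_div, sub_eq_zero, coe_div_eq_iff _ _ _ hb]
    exact ⟨r * v, by linear_combination -v * hrt⟩
  -- Gram–Schmidt: the second vector has norm numerator β - t v², where p divides β but neither t
  -- nor v.
  refine ⟨z, y' - (t * v) • z, α + 1, β - t * v * v, hz, ?_, hc, ?_, hzz, ?_, hort⟩
  · rw [smul_sub, hy', smul_comm, hz, smul_zero, sub_zero]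
  · intro h'
    have h1 := (dvd_sub_right hpβ).1 h'
    rcases hpp.dvd_mul.1 h1 with h1 | h1
    · rcases hpp.dvd_mul.1 h1 with h1 | h1
      exacts [hpt h1, hv h1]
    · exact hv h1
  · change μ (y' - (t * v) • z) (y' - (t * v) • z) =
      ((((β - t * v * v : ℤ) : ℚ) / b : ℚ) : RatModInt)
    rw [map_sub μ, AddMonoidHom.sub_apply, map_zsmul μ, AddMonoidHom.zsmul_apply, hort, smul_zero,
      sub_zero, map_sub, map_zsmul, hsμ y' z, hzy, hyy, zsmul_coe_div, ← AddCircle.coe_sub]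
    congr 1
    push_cast
    ring

/-! ### Induction on the order -/

theorem Isomorphic.card_eq {G H : Type*} [AddCommGroup G] [AddCommGroup H]
    {ν : QZPairing G} {μ : QZPairing H} (h : Isomorphic ν μ) : Nat.card G = Nat.card H :=
  Nat.card_congr h.choose.toEquiv

/-- Every nondegenerate symmetric pairing on a finite abelian group is stably diagonal, with
summands of prime power order for primes dividing the order of the group. -/
theorem Nondegenerate.stablyDiagonal {S : Set ℕ} (N : ℕ) :
    ∀ {G : Type*} [AddCommGroup G] [Finite G] {ν : QZPairing G}, ν.Nondegenerate →
      (∀ x y, ν x y = ν y x) → Nat.card G = N → (∀ p : ℕ, p.Prime → p ∣ N → p ∈ S) →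
      StablyDiagonal S ν := by
  induction N using Nat.strong_induction_on with
  | _ N ih =>
  intro G _ _ ν hν hs hN hS
  have hN0 : 0 < N := hN ▸ Nat.card_pos
  by_cases h1 : N = 1
  · have := (Nat.card_eq_one_iff_unique.1 (hN.trans h1)).1
    exact StablyDiagonal.of_subsingleton ν
  obtain ⟨p, hp, hpN⟩ := Nat.exists_prime_and_dvd h1
  have hpS := hS p hp hpN
  obtain ⟨m, x, y, v, hm, hx, hy, hv, hxy⟩ := hν.exists_apply_eq_coe_div hp (hN ▸ hpN)
  have hb : ((p : ℤ) ^ m) ≠ 0 := pow_ne_zero _ (by exact_mod_cast hp.ne_zero)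
  have hbN : NeZero ((p : ℤ) ^ m) := ⟨hb⟩
  have hcardb : Nat.card (ℤ ⧸ AddSubgroup.zmultiples ((p : ℤ) ^ m)) = p ^ m := by
    rw [card_quotient_zmultiples, Int.natAbs_pow, Int.natAbs_natCast]
  have hlt : ∀ M : ℕ, M * p ^ m = N → M < N ∧ M ∣ N := fun M hM => by
    refine ⟨?_, Dvd.intro _ hM⟩
    have hM0 : 0 < M := Nat.pos_of_ne_zero (by rintro rfl; omega)
    rw [← hM]
    exact lt_mul_of_one_lt_right hM0 (Nat.one_lt_pow hm.ne' hp.one_lt)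
  by_cases hex : ∃ (z : G) (c : ℤ), ((p : ℤ) ^ m) • z = 0 ∧
      ν z z = (((c : ℚ) / ((p : ℤ) ^ m : ℤ) : ℚ) : RatModInt) ∧ ¬ (p : ℤ) ∣ c
  · obtain ⟨z, c, hz, hzz, hc⟩ := hex
    have hbc := isCoprime_prime_pow_of_not_dvd hp m hc
    obtain ⟨hnd, hiso⟩ := isomorphic_blockSum_cyclicPairing hs hb hbc hz hzz hν
    have hcard := hiso.card_eq
    rw [Nat.card_prod, hcardb, hN] at hcard
    obtain ⟨hl, hd⟩ := hlt _ hcard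
    exact ((ih _ hl hnd (fun _ _ => hs _ _) rfl fun q hq hqd => hS q hq (hqd.trans hd)).blockSum
      hpS hm hb rfl hbc).congr hiso
  · push Not at hex
    obtain ⟨z, w, c, c', hz, hw, hc, hc', hzz, hww, hzw⟩ :=
      exists_norms_of_forall_dvd hs hp hb hm hx hy hv hxy hex
    have hbc := isCoprime_prime_pow_of_not_dvd hp m hc
    have hbc' := isCoprime_prime_pow_of_not_dvd hp m hc'
    have hs1 := blockSum_symm hs (cyclicPairing_symm _ 1 hb)
    have hν1 := hν.blockSum (cyclicPairing_nondegenerate hb isCoprime_one_right)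
    obtain ⟨hnd, hiso⟩ := isomorphic_blockSum_cyclicPairing hs1 hb hbc hz hzz hν1
    -- Orthogonality places w in the complement of z, so a second summand splits off there.
    let w' : (QZPairing.blockSum ν (cyclicPairing _ 1 hb) z).ker := ⟨w, hzw⟩
    obtain ⟨hnd', hiso'⟩ := isomorphic_blockSum_cyclicPairing (fun _ _ => hs1 _ _) hb hbc'
      (ν := (QZPairing.blockSum ν (cyclicPairing _ 1 hb)).restrict _)
      (z := w') (Subtype.ext hw) hww hnd
    have hcard := hiso.card_eq
    have hcard' := hiso'.card_eq
    rw [Nat.card_prod, Nat.card_prod, hcardb, hN] at hcard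
    rw [Nat.card_prod, hcardb] at hcard'
    -- One factor p^m was added and two were removed, so the remaining order is N / p^m.
    obtain ⟨hl, hd⟩ := hlt _ (hcard'.trans
      (Nat.eq_of_mul_eq_mul_right (pow_pos hp.pos m) hcard))
    have hH := ih _ hl hnd' (fun _ _ => hs1 _ _) rfl fun q hq hqd => hS q hq (hqd.trans hd)
    exact (((hH.blockSum hpS hm hb rfl hbc').congr hiso').blockSum hpS hm hb rfl hbc |>.congr
      hiso).of_blockSum hpS hm hb rfl isCoprime_one_right

end QZPairing

/-! ### The proposition -/

theorem mainTheorem8 {G : Type*} [AddCommGroup G] [Finite G]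
    (ν : QZPairing G) (hν : ν.IsLinkingPairing)
    (k : ℕ) (p e : Fin k → ℕ) (hp : ∀ i, (p i).Prime) (hinj : Function.Injective p)
    (he : ∀ i, 0 < e i) (hcard : Nat.card G = ∏ i, p i ^ e i) :
    ∃ (s : ℕ) (b a : Fin s → ℤ) (hb : ∀ j, b j ≠ 0),
      (∀ j, a j ≠ 0) ∧
      (∀ j, IsCoprime (b j) (a j)) ∧
      (∀ j, ∃ (i : Fin k) (m : ℕ), 0 < m ∧ b j = (p i : ℤ) ^ m) ∧
      (QZPairing.blockSum ν
        (QZPairing.blockSumFamily fun j => cyclicPairing (b j) (a j) (hb j))).IsDiagonalType := by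
  have hS : ∀ q : ℕ, q.Prime → q ∣ Nat.card G → q ∈ Set.range p := fun q hq hqd => by
    rw [hcard, hq.prime.dvd_finsetProd_iff] at hqd
    obtain ⟨i, -, hi⟩ := hqd
    exact ⟨i, ((Nat.prime_dvd_prime_iff_eq hq (hp i)).1 (hq.dvd_of_dvd_pow hi)).symm⟩
  obtain ⟨s, b, a, hb, hab, hbS, hdiag⟩ :=
    (hν.nondegenerate.stablyDiagonal _ hν.symm rfl hS).isDiagonalType
  have hbp : ∀ j, ∃ (i : Fin k) (m : ℕ), 0 < m ∧ b j = (p i : ℤ) ^ m := fun j => by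
    obtain ⟨_, ⟨i, rfl⟩, m, hm⟩ := hbS j
    exact ⟨i, m, hm⟩
  refine ⟨s, b, a, hb, fun j h0 => ?_, hab, hbp, hdiag⟩
  obtain ⟨i, m, hm, hbj⟩ := hbp j
  have hu := hab j
  -- If a j were zero, coprimality would make a positive power of a prime a unit.
  rw [h0, isCoprime_zero_right, hbj, isUnit_pow_iff hm.ne'] at hu
  exact (Nat.prime_iff_prime_int.1 (hp i)).not_isUnit hu
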